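/- Let $\Bbbk$ be a commutative ring and let $\mathcal{A}$ be an essentially small additive category. For an essentially small category $\mathcal{C}$, let $\mathcal{C}\text{-}\mathbf{Mod}$ denote the abelian category of all functors (not necessarily additive) from $\mathcal{C}$ to $\Bbbk$-modules. For $d\in\mathbb{N}$ and $I\subset\{0,\dots,d\}$, let $u_I(a):a\to a^{\oplus(d+1)}$ be the morphism whose $i$-th component ($0\le i\le d$) is $\mathrm{id}_a$ if $i\in I$ and $0$ otherwise. A functor $A\in\mathcal{A}\text{-}\mathbf{Mod}$ is polynomial of degree at most $d$ if $$\sum_{I\subset\{0,\dots,d\}}(-1)^{|I|}A(u_I(a))=0:\ A(a)\to A\big(a^{\oplus(d+1)}\big)$$ for every object $a$ of $\mathcal{A}$, and it is polynomial if it is polynomial of degree at most $d$ for some $d\in\mathbb{N}$. Let $\mathbf{M}(\mathcal{A})$ be the subcategory of $\mathcal{A}$ with the same objects and with the split monomorphisms of $\mathcal{A}$ as morphisms, and let $\alpha:\mathcal{A}\text{-}\mathbf{Mod}\to\mathbf{M}(\mathcal{A})\text{-}\mathbf{Mod}$ be the (exact, $\Bbbk$-linear) restriction functor. **Theorem (Scorichenko).**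 Let $A$ and $F$ be objects of $\mathcal{A}\text{-}\mathbf{Mod}$, with $A$ polynomial. Then for every $n\in\mathbb{N}$ the natural $\Bbbk$-linear map induced by the exact functor $\alpha$, $$\mathrm{Ext}^n_{\mathcal{A}\text{-}\mathbf{Mod}}(A,F)\longrightarrow\mathrm{Ext}^n_{\mathbf{M}(\mathcal{A})\text{-}\mathbf{Mod}}(\alpha(A),\alpha(F)),$$ is an isomorphism. -/

import Mathlib

open CategoryTheory CategoryTheory.Limits

universe w v u

namespace Scorichenko

noncomputable section

/-! ### Polynomial functors -/

section Polynomial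

variable {𝒜 : Type u} [Category.{v} 𝒜] [Preadditive 𝒜] [HasFiniteBiproducts 𝒜]

/-- The endofunctor `a ↦ a ^ ⊕(d+1)`, the summands being indexed by `{0, …, d}`. -/
@[simps]
def t (𝒜 : Type u) [Category.{v} 𝒜] [Preadditive 𝒜] [HasFiniteBiproducts 𝒜] (d : ℕ) :
    𝒜 ⥤ 𝒜 where
  obj a := ⨁ fun _ : Fin (d + 1) => a
  map f := biproduct.map fun _ => f

/-- For `I ⊆ {0, …, d}`, the natural morphism `a ⟶ a ^ ⊕(d+1)` whose `i`-th component is the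
identity if `i ∈ I` and zero otherwise. -/
@[simps]
def insertion (d : ℕ) (I : Finset (Fin (d + 1))) : 𝟭 𝒜 ⟶ t 𝒜 d where
  app a := biproduct.lift fun i => if i ∈ I then 𝟙 a else 0
  naturality a b f := by
    change f ≫ biproduct.lift (fun i => if i ∈ I then 𝟙 b else 0) =
      biproduct.lift (fun i => if i ∈ I then 𝟙 a else 0) ≫ biproduct.map fun _ => f
    refine biproduct.hom_ext _ _ fun i => ?_
    rw [Category.assoc, Category.assoc, biproduct.map_π, biproduct.lift_π,
      biproduct.lift_π_assoc]
    split_ifs <;> simp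

variable {k : Type w} [CommRing k]

/-- The cross effect `F ⟶ F ∘ t_d`, the alternating sum of the morphisms induced by the
insertions indexed by all subsets of `{0, …, d}`. -/
def crossEffect (d : ℕ) (F : 𝒜 ⥤ ModuleCat.{w} k) : F ⟶ t 𝒜 d ⋙ F :=
  ∑ I : Finset (Fin (d + 1)),
    (-1 : ℤ) ^ I.card • (F.leftUnitor.inv ≫ Functor.whiskerRight (insertion d I) F)

/-- `F` is polynomial of degree at most `d`. -/
def IsPolynomialOfDegreeLE (F : 𝒜 ⥤ ModuleCat.{w} k) (d : ℕ) : Prop :=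
  crossEffect d F = 0

/-- `F` is polynomial, i.e. polynomial of degree at most `d` for some natural number `d`. -/
def IsPolynomial (F : 𝒜 ⥤ ModuleCat.{w} k) : Prop :=
  ∃ d : ℕ, IsPolynomialOfDegreeLE F d

end Polynomial

/-! ### The category of split monomorphisms -/

section SplitMonos

/-- The class of split monomorphisms of a category. -/
def splitMonos (𝒜 : Type u) [Category.{v} 𝒜] : MorphismProperty 𝒜 :=
  fun _ _ f => IsSplitMono f

instance splitMonos_isMultiplicative (𝒜 : Type u) [Category.{v} 𝒜] :
    (splitMonos 𝒜).IsMultiplicative where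
  id_mem a := (inferInstance : IsSplitMono (𝟙 a))
  comp_mem f g hf hg := by
    have : IsSplitMono f := hf
    have : IsSplitMono g := hg
    exact (inferInstance : IsSplitMono (f ≫ g))

/-- The subcategory `M(𝒜)` of `𝒜` with the same objects, whose morphisms are the split
monomorphisms of `𝒜`. -/
abbrev M (𝒜 : Type u) [Category.{v} 𝒜] : Type u := WideSubcategory (splitMonos 𝒜)

instance essentiallySmall_M (𝒜 : Type u) [Category.{v} 𝒜] [EssentiallySmall.{w} 𝒜] :
    EssentiallySmall.{w} (M 𝒜) := by
  rw [essentiallySmall_iff]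
  constructor
  · let φ : Skeleton 𝒜 → Skeleton (M 𝒜) :=
      fun a => toSkeleton (⟨(fromSkeleton 𝒜).obj a⟩ : M 𝒜)
    refine small_of_surjective (f := φ) fun b => ?_
    let c : M 𝒜 := (fromSkeleton (M 𝒜)).obj b
    refine ⟨toSkeleton c.obj, ?_⟩
    have e : (fromSkeleton 𝒜).obj (toSkeleton c.obj) ≅ c.obj := fromSkeletonToSkeletonIso c.obj
    have e' : (⟨(fromSkeleton 𝒜).obj (toSkeleton c.obj)⟩ : M 𝒜) ≅ c :=
      WideSubcategory.isoMk e (inferInstance : IsSplitMono e.hom)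
        (inferInstance : IsSplitMono e.inv)
    have h : toSkeleton c = b := Quotient.out_eq b
    exact (Quotient.sound ⟨e'⟩ : toSkeleton _ = toSkeleton c).trans h
  · exact locallySmall_of_faithful (wideSubcategoryInclusion (splitMonos 𝒜))

end SplitMonos

/-! ### Categories of functors to `k`-modules -/

section Functors

/-- If `C` is essentially small, the functors from `C` to `k`-modules form a Grothendieck abelian
category; in particular its `Ext` groups are defined. -/
instance isGrothendieckAbelian_functor (C : Type u) [Category.{v} C] [EssentiallySmall.{w} C]
    (k : Type w) [CommRing k] :
    IsGrothendieckAbelian.{w} (C ⥤ ModuleCat.{w} k) := by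
  have : IsGrothendieckAbelian.{w} ((SmallModel.{w} C)ᵒᵖᵒᵖ ⥤ ModuleCat.{w} k) :=
    { ab5OfSize := ⟨fun _ _ _ => inferInstance⟩ }
  exact IsGrothendieckAbelian.of_equivalence
    (((opOpEquivalence (SmallModel.{w} C)).trans (equivSmallModel.{w} C).symm).congrLeft)

/-- The restriction functor from functors on `𝒜` to functors on `M(𝒜)`. -/
abbrev restriction (𝒜 : Type u) [Category.{v} 𝒜] (k : Type w) [CommRing k] :
    (𝒜 ⥤ ModuleCat.{w} k) ⥤ (M 𝒜 ⥤ ModuleCat.{w} k) :=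
  (Functor.whiskeringLeft (M 𝒜) 𝒜 (ModuleCat.{w} k)).obj
    (wideSubcategoryInclusion (splitMonos 𝒜))

instance preservesFiniteLimits_restriction (𝒜 : Type u) [Category.{v} 𝒜]
    (k : Type w) [CommRing k] :
    PreservesFiniteLimits (restriction 𝒜 k) := ⟨fun _ => inferInstance⟩

instance preservesFiniteColimits_restriction (𝒜 : Type u) [Category.{v} 𝒜]
    (k : Type w) [CommRing k] :
    PreservesFiniteColimits (restriction 𝒜 k) := ⟨fun _ => inferInstance⟩

instance linear_restriction (𝒜 : Type u) [Category.{v} 𝒜] (k : Type w) [CommRing k] :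
    (restriction 𝒜 k).Linear k where

end Functors

end

end Scorichenko

/-! By dimension shifting along injective embeddings, an exact functor is bijective on `Ext` out of
`A` once it is so on `Hom` and sends injectives to objects acyclic for the image of `A`
(`mapExactFunctor_bijective`). Both conditions rest on one device: for a morphism `f : a ⟶ b`, the
graph `(u_I, f) : a ⟶ a^(d+1) ⊞ b` is a split monomorphism as soon as `I` is nonempty, while for `I
= ∅` it is `f` followed by the inclusion of `b`. If `A` has degree at most `d`, the alternating sum
of the values of `A` on these graphs vanishes, so whatever is known for split monomorphisms
determines the term of `f` itself.

For `Hom`, this makes a family natural for split monomorphisms natural for all `f`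
(`naturality_of_splitMonos`). For acyclicity, an injective functor is a retract of a coinduced one,
and an adjunction moves the question to `MOver R`, the category of arrows `a ⟶ R b`. There `f ↦
(a^(d+1) ⊞ R b ⟶ R b)` is an endofunctor: a nonempty `I` recovers the class `x`, whereas `I = ∅`
factors through the identities of the `R b`, over which positive `Ext` into an injective vanishes.
Hence `x = 0` (`ext_pullback_snd_eq_zero`). -/

namespace CategoryTheory.Abelian.Ext

-- Exact functors, natural transformations and adjunctions on `Ext`

universe w₁ w₂ w₃ v₁ v₂ v₃ u₁ u₂ u₃

variable {C : Type u₁} [Category.{v₁} C] [Abelian C] [HasExt.{w₁} C]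
  {D : Type u₂} [Category.{v₂} D] [Abelian D] [HasExt.{w₂} D]
  {E : Type u₃} [Category.{v₃} E] [Abelian E] [HasExt.{w₃} E]

/-- In a category with enough injectives, every `Ext` class is obtained from a morphism by
successive Yoneda products with classes of short exact sequences. -/
theorem induction_of_enoughInjectives [EnoughInjectives C]
    {P : ∀ ⦃X Y : C⦄ ⦃n : ℕ⦄, Ext.{w₁} X Y n → Prop}
    (mk₀ : ∀ ⦃X Y : C⦄ (f : X ⟶ Y), P (mk₀ f))
    (comp_extClass : ∀ ⦃S : ShortComplex C⦄ (hS : S.ShortExact) ⦃X : C⦄ ⦃n : ℕ⦄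
      (x : Ext.{w₁} X S.X₃ n), P x → P (x.comp hS.extClass rfl))
    {X Y : C} {n : ℕ} (x : Ext.{w₁} X Y n) : P x := by
  induction n generalizing Y with
  | zero =>
    obtain ⟨f, rfl⟩ := (mk₀_bijective X Y).2 x
    exact mk₀ f
  | succ n ih =>
    let S : ShortComplex C := .mk (Injective.ι Y) (cokernel.π _) (cokernel.condition _)
    have hS : S.ShortExact := { exact := ShortComplex.exact_cokernel _ }
    have : Injective S.X₂ := inferInstanceAs (Injective (Injective.under Y))
    obtain ⟨y, rfl⟩ := covariant_sequence_exact₁ X hS x (eq_zero_of_injective _) rfl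
    exact comp_extClass hS y (ih y)

section

variable {F G : C ⥤ D} [F.Additive] [PreservesFiniteLimits F] [PreservesFiniteColimits F]
  [G.Additive] [PreservesFiniteLimits G] [PreservesFiniteColimits G]

/-- In degree 0 this is the naturality of `τ`; on the class of a short exact sequence it holds
because `τ` gives a morphism between the two image sequences. Yoneda products propagate it to all
degrees. -/
theorem mapExactFunctor_naturality [EnoughInjectives C] (τ : F ⟶ G)
    {X Y : C} {n : ℕ} (x : Ext.{w₁} X Y n) :
    (mk₀ (τ.app X)).comp (x.mapExactFunctor G) (zero_add n) =
      (x.mapExactFunctor F).comp (mk₀ (τ.app Y)) (add_zero n) := by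
  induction x using induction_of_enoughInjectives with
  | mk₀ f => simp [mapExactFunctor_mk₀]
  | comp_extClass hS x hx =>
    have h : (mk₀ (τ.app _)).comp (hS.extClass.mapExactFunctor G) (zero_add 1) =
        (hS.extClass.mapExactFunctor F).comp (mk₀ (τ.app _)) (add_zero 1) := by
      rw [mapExactFunctor_extClass, mapExactFunctor_extClass]
      exact ((hS.map_of_exact F).extClass_naturality (hS.map_of_exact G)
        (ShortComplex.mapNatTrans _ τ)).symm
    rw [mapExactFunctor_comp, mapExactFunctor_comp, comp_assoc_of_third_deg_zero, ← h,
      ← comp_assoc _ _ _ (zero_add _) rfl (by omega), hx, comp_assoc_of_second_deg_zero]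

variable (F)

theorem mapExactFunctor_id [EnoughInjectives C] {X Y : C} {n : ℕ} (x : Ext.{w₁} X Y n) :
    x.mapExactFunctor (𝟭 C) = x := by
  induction x using induction_of_enoughInjectives with
  | mk₀ f => simp [mapExactFunctor_mk₀]
  | comp_extClass hS x hx =>
    rw [mapExactFunctor_comp, hx, mapExactFunctor_extClass]
    rfl

theorem mapExactFunctor_functorComp [EnoughInjectives C] (H : D ⥤ E) [H.Additive]
    [PreservesFiniteLimits H] [PreservesFiniteColimits H]
    {X Y : C} {n : ℕ} (x : Ext.{w₁} X Y n) :
    x.mapExactFunctor (F ⋙ H) = (x.mapExactFunctor F).mapExactFunctor H := by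
  induction x using induction_of_enoughInjectives with
  | mk₀ f => simp [mapExactFunctor_mk₀]
  | comp_extClass hS x hx =>
    rw [mapExactFunctor_comp, hx, mapExactFunctor_comp, mapExactFunctor_comp]
    congr 1
    exact (mapExactFunctor_extClass (F ⋙ H) hS).trans
      ((mapExactFunctor_extClass H (hS.map_of_exact F)).symm.trans
        (congrArg (mapExactFunctor H) (mapExactFunctor_extClass F hS).symm))

/-- A criterion for an exact functor to induce isomorphisms on `Ext`: it suffices that it does so
on morphisms out of `A` and that it sends injective objects to objects which are acyclic with
respect to the image of `A`. -/
theorem mapExactFunctor_bijective [EnoughInjectives C] (A : C)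
    (h₀ : ∀ Y : C, Function.Bijective (F.map : (A ⟶ Y) → _))
    (h : ∀ (I : C) [Injective I] (n : ℕ) (x : Ext.{w₂} (F.obj A) (F.obj I) (n + 1)), x = 0)
    (Y : C) (n : ℕ) :
    Function.Bijective (mapExactFunctor F : Ext.{w₁} A Y n → Ext.{w₂} (F.obj A) (F.obj Y) n) := by
  induction n generalizing Y with
  | zero => simpa [mapExactFunctor₀] using h₀ Y
  | succ n ih =>
    let S : ShortComplex C := .mk (Injective.ι Y) (cokernel.π _) (cokernel.condition _)
    have hS : S.ShortExact := { exact := ShortComplex.exact_cokernel _ }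
    have : Injective S.X₂ := inferInstanceAs (Injective (Injective.under Y))
    have hS' := hS.map_of_exact F
    refine ⟨(injective_iff_map_eq_zero (F.mapExtAddHom A Y (n + 1))).2 fun x hx => ?_, fun x => ?_⟩
    · obtain ⟨y, rfl⟩ := covariant_sequence_exact₁ A hS x (eq_zero_of_injective _) rfl
      rw [Functor.mapExtAddHom_apply, mapExactFunctor_comp, mapExactFunctor_extClass] at hx
      -- The connecting map kills the image of `y`, which therefore lifts to the injective middle
      -- term. By induction the lift comes from `C`, so `y` itself lifts and its boundary vanishes.
      obtain ⟨z, hz⟩ := covariant_sequence_exact₃ (F.obj A) hS' (y.mapExactFunctor F) rfl hx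
      obtain ⟨z, rfl⟩ := (ih S.X₂).2 z
      have hz' : (z.comp (mk₀ S.g) (add_zero n)) = y := (ih S.X₃).1 (by
        rw [mapExactFunctor_comp, mapExactFunctor_mk₀]
        exact hz)
      rw [← hz', comp_assoc_of_second_deg_zero, hS.comp_extClass, comp_zero]
    · obtain ⟨y, hy⟩ := covariant_sequence_exact₁ (F.obj A) hS' x (h S.X₂ n _) rfl
      obtain ⟨y, rfl⟩ := (ih S.X₃).2 y
      exact ⟨y.comp hS.extClass rfl, by
        rw [mapExactFunctor_comp, mapExactFunctor_extClass]
        exact hy⟩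

end

/-- If `L ⊣ R` are exact functors, the vanishing of `Ext (L X) Y` implies that of `Ext X (R Y)`. -/
theorem eq_zero_of_adjunction [EnoughInjectives C] [EnoughInjectives D] {L : C ⥤ D} {R : D ⥤ C}
    (adj : L ⊣ R) [L.Additive] [R.Additive] [PreservesFiniteLimits L] [PreservesFiniteColimits R]
    [PreservesFiniteColimits L] [PreservesFiniteLimits R] {X : C} {Y : D} {n : ℕ}
    (h : ∀ x : Ext.{w₂} (L.obj X) Y n, x = 0) (x : Ext.{w₁} X (R.obj Y) n) : x = 0 := by
  -- The adjunct of `x` is `L x` followed by the counit, which vanishes by `h`. Applying `R` and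
  -- precomposing with the unit recovers `x`, by naturality of the unit and a triangle identity.
  have h₁ := congrArg (mapExactFunctor R)
    (h ((x.mapExactFunctor L).comp (mk₀ (adj.counit.app Y)) (add_zero n)))
  rw [mapExactFunctor_comp, mapExactFunctor_mk₀, mapExactFunctor_zero,
    ← mapExactFunctor_functorComp] at h₁
  have h₂ := mapExactFunctor_naturality adj.unit x
  rw [mapExactFunctor_id] at h₂
  have h₃ := congrArg (fun y => (mk₀ (adj.unit.app X)).comp y (zero_add n)) h₁
  have h₄ := congrArg (fun y => Ext.comp y (mk₀ (R.map (adj.counit.app Y))) (add_zero n)) h₂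
  rw [comp_assoc_of_third_deg_zero] at h₄
  have h₅ := h₄.symm.trans (h₃.trans (comp_zero ..))
  rw [comp_assoc_of_third_deg_zero, mk₀_comp_mk₀] at h₅
  have h₆ : mk₀ (adj.unit.app (R.obj Y) ≫ R.map (adj.counit.app Y)) = mk₀ (𝟙 (R.obj Y)) :=
    congrArg mk₀ (adj.right_triangle_components Y)
  exact (comp_mk₀_id x).symm.trans
    ((congrArg (fun y => x.comp y (add_zero n)) h₆).symm.trans h₅)

end CategoryTheory.Abelian.Ext

/-! ### Smallness of comma categories and exactness of products of modules -/

namespace Scorichenko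

noncomputable section

universe v₁ u₁

/-- Over a small model of `M`, the objects are triples drawn from small sets. This makes `Ext`
available for functors on `MOver R`. -/
theorem essentiallySmall_comma {M : Type u₁} [Category.{v₁} M] {T : Type u} [Category.{v} T]
    [EssentiallySmall.{w} M] [LocallySmall.{w} T] {J : Type w} (L : M ⥤ T) (R : Discrete J ⥤ T) :
    EssentiallySmall.{w} (Comma L R) := by
  rw [← essentiallySmall_congr
    (Comma.preLeft (equivSmallModel.{w} M).inverse L R).asEquivalence]
  have : Small.{w} (Comma ((equivSmallModel.{w} M).inverse ⋙ L) R) :=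
    small_of_surjective
      (f := fun x : (Σ (a : SmallModel.{w} M) (b : Discrete J),
        ((equivSmallModel.{w} M).inverse ⋙ L).obj a ⟶ R.obj b) =>
          (⟨x.1, x.2.1, x.2.2⟩ : Comma ((equivSmallModel.{w} M).inverse ⋙ L) R))
      fun ⟨a, b, f⟩ => ⟨⟨a, b, f⟩, rfl⟩
  exact essentiallySmall_of_small_of_locallySmall _

section Products

variable {k : Type w} [CommRing k] {I : Type u} [Small.{w} I]

instance hasProductsOfShape_of_small_moduleCat : HasProductsOfShape I (ModuleCat.{w} k) :=
  hasProductsOfShape_of_small.{w} _ _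

instance epi_piMap {X Y : I → ModuleCat.{w} k} (f : ∀ i, X i ⟶ Y i) [∀ i, Epi (f i)] :
    Epi (Limits.Pi.map f) := by
  have : HasExactLimitsOfShape (Discrete I) (ModuleCat.{w} k) :=
    .of_domain_equivalence _ (Discrete.equivalence (equivShrink.{w} I)).symm
  have : ∀ i, Epi ((Discrete.natTrans fun i : Discrete I => f i.as :
    Discrete.functor X ⟶ Discrete.functor Y).app i) := fun i => inferInstanceAs (Epi (f i.as))
  have : Epi (Discrete.natTrans fun i : Discrete I => f i.as :
    Discrete.functor X ⟶ Discrete.functor Y) := NatTrans.epi_of_epi_app _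
  exact inferInstanceAs (Epi (lim.map (Discrete.natTrans fun i : Discrete I => f i.as :
    Discrete.functor X ⟶ Discrete.functor Y)))

end Products

/-! ### Right Kan extension along the projection of a comma category -/

section Coinduction

variable {M : Type u₁} [Category.{v₁} M] {T : Type u} [Category.{v} T]
  [LocallySmall.{w} T] {J : Type w} (L : M ⥤ T) (R : Discrete J ⥤ T)
  {k : Type w} [CommRing k]

-- The commutative squares force `x = x'`, because `R` has a discrete source. Comparing left
-- components thus avoids transport along equalities of indices.
variable {L R} in
theorem pi_π_comp_map {G : Comma L R ⥤ ModuleCat.{w} k} {a : M}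
    {x x' : Σ b : Discrete J, L.obj a ⟶ R.obj b} {Y : Comma L R}
    (m : (⟨a, x.1, x.2⟩ : Comma L R) ⟶ Y) (m' : (⟨a, x'.1, x'.2⟩ : Comma L R) ⟶ Y)
    (h : m.left = m'.left) :
    Pi.π (fun x : (Σ b : Discrete J, L.obj a ⟶ R.obj b) => G.obj ⟨a, x.1, x.2⟩) x ≫ G.map m =
      Pi.π (fun x : (Σ b : Discrete J, L.obj a ⟶ R.obj b) => G.obj ⟨a, x.1, x.2⟩) x' ≫
        G.map m' := by
  obtain ⟨⟨b⟩, f⟩ := x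
  obtain ⟨⟨b'⟩, f'⟩ := x'
  obtain ⟨c, ⟨e⟩, g⟩ := Y
  obtain ⟨l, ⟨⟨hr⟩⟩, w⟩ := m
  obtain ⟨l', ⟨⟨hr'⟩⟩, w'⟩ := m'
  dsimp only at h hr hr'
  subst h hr hr'
  obtain rfl : f = f' := by
    have h₁ : L.map l ≫ g = f ≫ R.map (𝟙 _) := w
    have h₂ : L.map l ≫ g = f' ≫ R.map (𝟙 _) := w'
    rw [R.map_id, Category.comp_id] at h₁ h₂
    exact h₁.symm.trans h₂
  rfl

variable {L R} in
/-- The morphism of `Comma L R` with target `⟨a', b, f⟩` induced by a morphism `a ⟶ a'`. -/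
@[simps]
def commaLift {a a' : M} (φ : a ⟶ a') (b : Discrete J) (f : L.obj a' ⟶ R.obj b) :
    (⟨a, b, L.map φ ≫ f⟩ : Comma L R) ⟶ ⟨a', b, f⟩ where
  left := φ
  right := 𝟙 b

/-- The right Kan extension along `Comma.fst L R` of a functor. -/
def coinduceObj (G : Comma L R ⥤ ModuleCat.{w} k) : M ⥤ ModuleCat.{w} k where
  obj a := ∏ᶜ fun x : (Σ b : Discrete J, L.obj a ⟶ R.obj b) => G.obj ⟨a, x.1, x.2⟩
  map {a a'} φ := Pi.lift fun x => Pi.π (fun x : (Σ b : Discrete J, L.obj a ⟶ R.obj b) =>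
      G.obj ⟨a, x.1, x.2⟩) ⟨x.1, L.map φ ≫ x.2⟩ ≫ G.map (commaLift φ x.1 x.2)
  map_id a := by
    refine Pi.hom_ext _ _ fun x => (Pi.lift_π _ _).trans ?_
    refine (pi_π_comp_map (G := G) (x := ⟨x.1, L.map (𝟙 a) ≫ x.2⟩) (x' := x)
      (Y := ⟨a, x.1, x.2⟩) (commaLift (𝟙 a) x.1 x.2) (𝟙 _) rfl).trans ?_
    rw [G.map_id, Category.comp_id, Category.id_comp]
  map_comp {a a' a''} φ ψ := by
    refine Pi.hom_ext _ _ fun x => ?_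
    rw [Pi.lift_π, Category.assoc, Pi.lift_π, ← Category.assoc, Pi.lift_π, Category.assoc,
      ← G.map_comp]
    exact pi_π_comp_map (x := ⟨x.1, L.map (φ ≫ ψ) ≫ x.2⟩)
      (x' := ⟨x.1, L.map φ ≫ L.map ψ ≫ x.2⟩) _ _ rfl

variable {L R} in
/-- The projections of a coinduced functor. -/
def coinduceProj (G : Comma L R ⥤ ModuleCat.{w} k) (c : Comma L R) :
    (coinduceObj L R G).obj c.left ⟶ G.obj c :=
  Pi.π (fun x : (Σ b : Discrete J, L.obj c.left ⟶ R.obj b) =>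
    G.obj ⟨c.left, x.1, x.2⟩) ⟨c.right, c.hom⟩

variable {L R} in
/-- The universal property of the values of a coinduced functor. -/
def coinduceLift (G : Comma L R ⥤ ModuleCat.{w} k) {a : M} {Z : ModuleCat.{w} k}
    (θ : ∀ (b : Discrete J) (f : L.obj a ⟶ R.obj b), Z ⟶ G.obj ⟨a, b, f⟩) :
    Z ⟶ (coinduceObj L R G).obj a :=
  Pi.lift fun x => θ x.1 x.2

variable {L R} in
@[simp]
theorem coinduceLift_proj (G : Comma L R ⥤ ModuleCat.{w} k) {a : M} {Z : ModuleCat.{w} k}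
    (θ : ∀ (b : Discrete J) (f : L.obj a ⟶ R.obj b), Z ⟶ G.obj ⟨a, b, f⟩) (b : Discrete J)
    (f : L.obj a ⟶ R.obj b) :
    coinduceLift G θ ≫ coinduceProj G ⟨a, b, f⟩ = θ b f :=
  Pi.lift_π _ _

variable {L R} in
@[simp]
theorem coinduceLift_proj_assoc (G : Comma L R ⥤ ModuleCat.{w} k) {a : M} {Z Z' : ModuleCat.{w} k}
    (θ : ∀ (b : Discrete J) (f : L.obj a ⟶ R.obj b), Z ⟶ G.obj ⟨a, b, f⟩) (b : Discrete J)
    (f : L.obj a ⟶ R.obj b) (g : G.obj ⟨a, b, f⟩ ⟶ Z') :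
    coinduceLift G θ ≫ coinduceProj G ⟨a, b, f⟩ ≫ g = θ b f ≫ g := by
  rw [← Category.assoc, coinduceLift_proj]

variable {L R} in
theorem coinduceObj_hom_ext {G : Comma L R ⥤ ModuleCat.{w} k} {a : M} {Z : ModuleCat.{w} k}
    {g g' : Z ⟶ (coinduceObj L R G).obj a}
    (h : ∀ (b : Discrete J) (f : L.obj a ⟶ R.obj b),
      g ≫ coinduceProj G ⟨a, b, f⟩ = g' ≫ coinduceProj G ⟨a, b, f⟩) : g = g' :=
  Pi.hom_ext _ _ fun x => h x.1 x.2

variable {L R} in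
theorem coinduceObj_map_proj (G : Comma L R ⥤ ModuleCat.{w} k) {c c' : Comma L R} (m : c ⟶ c') :
    (coinduceObj L R G).map m.left ≫ coinduceProj G c' = coinduceProj G c ≫ G.map m :=
  (Pi.lift_π _ _).trans (pi_π_comp_map (x' := ⟨c.right, c.hom⟩) _ m rfl)

variable {L R} in
theorem coinduceObj_map_proj_mk (G : Comma L R ⥤ ModuleCat.{w} k) {a a' : M} (φ : a ⟶ a')
    (b : Discrete J) (f : L.obj a' ⟶ R.obj b) :
    (coinduceObj L R G).map φ ≫ coinduceProj G ⟨a', b, f⟩ =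
      coinduceProj G ⟨a, b, L.map φ ≫ f⟩ ≫
        G.map (commaLift φ b f) :=
  coinduceObj_map_proj G (commaLift φ b f)

/-- The right Kan extension along `Comma.fst L R`, computed as a product since `R` has a discrete
source. -/
def coinduce : (Comma L R ⥤ ModuleCat.{w} k) ⥤ (M ⥤ ModuleCat.{w} k) where
  obj G := coinduceObj L R G
  map {G G'} θ :=
    { app := fun a => coinduceLift G' fun b f => coinduceProj G ⟨a, b, f⟩ ≫ θ.app ⟨a, b, f⟩
      naturality := fun a a' φ => coinduceObj_hom_ext fun b f => by
        rw [Category.assoc, Category.assoc, coinduceLift_proj, coinduceObj_map_proj_mk,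
          coinduceLift_proj_assoc, ← Category.assoc, coinduceObj_map_proj_mk, Category.assoc,
          Category.assoc, θ.naturality] }
  map_id G := by
    ext a : 2
    exact coinduceObj_hom_ext fun b f => by simp
  map_comp θ θ' := by
    ext a : 2
    exact coinduceObj_hom_ext fun b f => by simp

variable {L R} in
@[simp]
theorem coinduce_map_app_proj {G G' : Comma L R ⥤ ModuleCat.{w} k} (θ : G ⟶ G') (a : M)
    (b : Discrete J) (f : L.obj a ⟶ R.obj b) :
    ((coinduce L R).map θ).app a ≫ coinduceProj G' ⟨a, b, f⟩ =
      coinduceProj G ⟨a, b, f⟩ ≫ θ.app ⟨a, b, f⟩ :=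
  coinduceLift_proj _ _ _ _

variable (k) in
/-- The unit of the adjunction between restriction along `Comma.fst L R` and coinduction. -/
def coinduceUnit : 𝟭 (M ⥤ ModuleCat.{w} k) ⟶
    (Functor.whiskeringLeft _ _ (ModuleCat.{w} k)).obj (Comma.fst L R) ⋙ coinduce L R where
  app X :=
    { app := fun a => coinduceLift (Comma.fst L R ⋙ X) fun _ _ => 𝟙 (X.obj a)
      naturality := fun a a' φ => coinduceObj_hom_ext (G := Comma.fst L R ⋙ X) fun b f => by
        refine (Category.assoc _ _ _).trans ?_
        refine (congrArg (X.map φ ≫ ·) (coinduceLift_proj _ _ _ _)).trans ?_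
        refine Eq.trans ?_ (Category.assoc _ _ _).symm
        refine Eq.trans ?_ (congrArg (_ ≫ ·) (coinduceObj_map_proj_mk _ _ _ _).symm)
        refine Eq.trans ?_ (coinduceLift_proj_assoc _ _ _ _ _).symm
        exact (Category.comp_id _).trans (Category.id_comp _).symm }
  naturality X X' θ := by
    ext a : 2
    refine coinduceObj_hom_ext (G := Comma.fst L R ⋙ X') fun b f => ?_
    refine (Category.assoc _ _ _).trans ?_
    refine (congrArg (θ.app a ≫ ·) (coinduceLift_proj _ _ _ _)).trans ?_
    refine Eq.trans ?_ (Category.assoc _ _ _).symm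
    refine Eq.trans ?_ (congrArg (_ ≫ ·) (coinduce_map_app_proj _ _ _ _).symm)
    refine Eq.trans ?_ (coinduceLift_proj_assoc _ _ _ _ _).symm
    exact (Category.comp_id _).trans (Category.id_comp _).symm

variable (k) in
/-- The counit of the adjunction between restriction along `Comma.fst L R` and coinduction. -/
def coinduceCounit : coinduce L R ⋙
    (Functor.whiskeringLeft _ _ (ModuleCat.{w} k)).obj (Comma.fst L R) ⟶ 𝟭 _ where
  app G :=
    { app := fun c => coinduceProj G c
      naturality := fun c c' m => coinduceObj_map_proj G m }
  naturality G G' θ := by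
    ext c : 2
    exact coinduce_map_app_proj θ _ _ _

/-- Restriction along `Comma.fst L R` is left adjoint to `coinduce L R`. -/
def coinduceAdjunction :
    (Functor.whiskeringLeft _ _ (ModuleCat.{w} k)).obj (Comma.fst L R) ⊣ coinduce L R where
  unit := coinduceUnit L R k
  counit := coinduceCounit L R k
  left_triangle_components X := by
    ext c : 2
    exact coinduceLift_proj (Comma.fst L R ⋙ X) (fun _ _ => 𝟙 (X.obj c.left)) c.right c.hom
  right_triangle_components G := by
    ext a : 2
    refine coinduceObj_hom_ext (G := G) fun b f => ?_
    refine (Category.assoc _ _ _).trans ?_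
    refine (congrArg (_ ≫ ·) (coinduce_map_app_proj _ _ _ _)).trans ?_
    exact coinduceLift_proj_assoc _ _ _ _ _

instance additive_coinduce : (coinduce L R : _ ⥤ (M ⥤ ModuleCat.{w} k)).Additive where
  map_add := by
    intro G G' θ θ'
    ext a : 2
    refine coinduceObj_hom_ext (G := G') fun b f => ?_
    refine (coinduce_map_app_proj _ _ _ _).trans ?_
    rw [NatTrans.app_add, NatTrans.app_add]
    refine Eq.trans ?_ (Preadditive.add_comp _ _ _ _ _ _).symm
    refine Eq.trans ?_ (congrArg₂ (· + ·) (coinduce_map_app_proj _ _ _ _).symm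
      (coinduce_map_app_proj _ _ _ _).symm)
    exact Preadditive.comp_add _ _ _ _ _ _

instance preservesFiniteLimits_coinduce :
    PreservesFiniteLimits (coinduce L R : _ ⥤ (M ⥤ ModuleCat.{w} k)) :=
  by
  have := (coinduceAdjunction L R (k := k)).rightAdjoint_preservesLimits
  exact ⟨fun _ _ _ => this.preservesLimitsOfShape⟩

/-- A right adjoint is already left exact, so only epimorphisms matter; they are preserved because
the values are products and products of modules are exact. -/
instance preservesFiniteColimits_coinduce :
    PreservesFiniteColimits (coinduce L R : _ ⥤ (M ⥤ ModuleCat.{w} k)) := by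
  rw [Functor.preservesFiniteColimits_iff_forall_exact_map_and_epi]
  have h := (Functor.preservesFiniteLimits_iff_forall_exact_map_and_mono
    (coinduce L R : _ ⥤ (M ⥤ ModuleCat.{w} k))).1 inferInstance
  refine fun S hS => ⟨(h S hS).1, ?_⟩
  have := hS.epi_g
  have (c : Comma L R) : Epi (S.g.app c) := inferInstance
  have (a : M) : Epi (((coinduce L R).map S.g).app a) := by
    exact inferInstanceAs (Epi (Limits.Pi.map fun x :
      (Σ b : Discrete J, L.obj a ⟶ R.obj b) => S.g.app ⟨a, x.1, x.2⟩))
  exact NatTrans.epi_of_epi_app _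

end Coinduction

end

end Scorichenko

namespace Scorichenko

noncomputable section

/-! ### Deviations of polynomial functors -/

/-- If all the deviations of `g` at the origin on families indexed by `ι` vanish, then so do its
deviations at any other base point. -/
theorem sum_deviation_eq_zero {ι H G : Type*} [Fintype ι] [DecidableEq ι] [Nonempty ι]
    [AddCommGroup H] [AddCommGroup G] (g : H → G)
    (hg : ∀ x : ι → H, ∑ I : Finset ι, (-1 : ℤ) ^ I.card • g (∑ i ∈ I, x i) = 0)
    (x : ι → H) (y : H) :
    ∑ I : Finset ι, (-1 : ℤ) ^ I.card • g (y + ∑ i ∈ I, x i) = 0 := by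
  obtain ⟨i₀⟩ := ‹Nonempty ι›
  let s : Finset ι := Finset.univ.erase i₀
  have hs : i₀ ∉ s := Finset.notMem_erase _ _
  -- `h` is the deviation in the directions other than `i₀`, so the full deviation is `h y - h (y +
  -- x i₀)`. At base point 0, with `x i₀` replaced by an arbitrary `z`, the hypothesis gives `h z =
  -- h 0`; hence `h` is constant.
  let h : H → G := fun y => ∑ I ∈ s.powerset, (-1 : ℤ) ^ I.card • g (y + ∑ i ∈ I, x i)
  have split (x' : ι → H) (hx' : ∀ i ∈ s, x' i = x i) (y : H) :
      ∑ I : Finset ι, (-1 : ℤ) ^ I.card • g (y + ∑ i ∈ I, x' i) = h y - h (y + x' i₀) := by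
    rw [← Finset.powerset_univ, ← Finset.insert_erase (Finset.mem_univ i₀),
      Finset.sum_powerset_insert hs, sub_eq_add_neg, ← Finset.sum_neg_distrib]
    congr 1
    · refine Finset.sum_congr rfl fun I hI => ?_
      rw [Finset.sum_congr rfl fun i hi => hx' i (Finset.mem_powerset.1 hI hi)]
    · refine Finset.sum_congr rfl fun I hI => ?_
      have hI₀ : i₀ ∉ I := fun hi => hs (Finset.mem_powerset.1 hI hi)
      rw [Finset.card_insert_of_notMem hI₀, Finset.sum_insert hI₀,
        Finset.sum_congr rfl fun i hi => hx' i (Finset.mem_powerset.1 hI hi), pow_succ,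
        mul_neg_one, neg_smul, add_assoc]
  have const (z : H) : h z = h 0 := by
    have h₁ := split (Function.update x i₀ z)
      (fun i hi => Function.update_of_ne (Finset.ne_of_mem_erase hi) _ _) 0
    simp only [zero_add, Function.update_self] at h₁
    exact (sub_eq_zero.1 (h₁.symm.trans (hg _))).symm
  rw [split x (fun _ _ => rfl), const, const (y + x i₀), sub_self]

/-- Since `ι` is nonempty, the signs of all subsets add up to 0, so those of the nonempty ones add
up to `-1` and the sum is `g ∅ - z`. -/
theorem eq_of_alternating_sum_eq_zero {ι G : Type*} [Fintype ι] [DecidableEq ι] [Nonempty ι]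
    [AddCommGroup G] (g : Finset ι → G) (z : G) (hg : ∀ I, I ≠ ∅ → g I = z)
    (h : ∑ I : Finset ι, (-1 : ℤ) ^ I.card • g I = 0) : g ∅ = z := by
  have h₀ : ∑ I : Finset ι, (-1 : ℤ) ^ I.card = 0 := by
    rw [← Finset.powerset_univ, Finset.sum_powerset_neg_one_pow_card,
      if_neg Finset.univ_nonempty.ne_empty]
  rw [← Finset.add_sum_erase _ _ (Finset.mem_univ ∅), Finset.card_empty, pow_zero] at h₀
  rw [← Finset.add_sum_erase _ _ (Finset.mem_univ ∅), Finset.sum_congr rfl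
    (fun I hI => by rw [hg I (Finset.ne_of_mem_erase hI)]), ← Finset.sum_smul,
    eq_neg_of_add_eq_zero_right h₀, Finset.card_empty, pow_zero, one_smul, neg_one_smul] at h
  exact eq_of_sub_eq_zero ((sub_eq_add_neg _ _).trans h)

/-! ### Graphs of arbitrary morphisms as split monomorphisms -/

section Stabilization

attribute [local instance] hasBinaryBiproducts_of_finite_biproducts

variable {𝒜 : Type u} [Category.{v} 𝒜] [Preadditive 𝒜] [HasFiniteBiproducts 𝒜]
  {k : Type w} [CommRing k]

theorem sum_map_sum_eq_zero {A : 𝒜 ⥤ ModuleCat.{w} k} {d : ℕ} (hA : IsPolynomialOfDegreeLE A d)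
    {a b : 𝒜} (x : Fin (d + 1) → (a ⟶ b)) :
    ∑ I : Finset (Fin (d + 1)), (-1 : ℤ) ^ I.card • A.map (∑ i ∈ I, x i) = 0 := by
  have h := congrArg (fun θ : A ⟶ t 𝒜 d ⋙ A => θ.app a) (show crossEffect d A = 0 from hA)
  simp only [crossEffect, NatTrans.app_sum, NatTrans.app_zsmul, NatTrans.comp_app,
    Functor.whiskerRight_app, insertion_app, Functor.leftUnitor_inv_app, Category.id_comp,
    NatTrans.app_zero] at h
  replace h : ∑ I : Finset (Fin (d + 1)), (-1 : ℤ) ^ I.card •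
      A.map (biproduct.lift fun i => if i ∈ I then 𝟙 a else 0) = 0 := h
  replace h := congrArg (fun θ => θ ≫ A.map (biproduct.desc x)) h
  simp only [Preadditive.sum_comp, Preadditive.zsmul_comp, zero_comp] at h
  refine Eq.trans (Finset.sum_congr rfl fun I _ => ?_) h
  congr 1
  refine Eq.trans ?_ (A.map_comp _ _)
  rw [biproduct.lift_desc]
  congr 1
  simp only [ite_comp, Category.id_comp, zero_comp, Finset.sum_ite_mem, Finset.univ_inter]

/-- The morphism `a ⟶ a ^ ⊕(d+1) ⊞ b` whose components are an insertion and a given morphism. -/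
def graphInsertion (d : ℕ) (I : Finset (Fin (d + 1))) {a b : 𝒜} (f : a ⟶ b) :
    a ⟶ (⨁ fun _ : Fin (d + 1) => a) ⊞ b :=
  biprod.lift (biproduct.lift fun i => if i ∈ I then 𝟙 a else 0) f

theorem graphInsertion_snd (d : ℕ) (I : Finset (Fin (d + 1))) {a b : 𝒜} (f : a ⟶ b) :
    graphInsertion d I f ≫ biprod.snd = f :=
  biprod.lift_snd _ _

theorem graphInsertion_empty (d : ℕ) {a b : 𝒜} (f : a ⟶ b) :
    graphInsertion d ∅ f = f ≫ biprod.inr := by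
  refine biprod.hom_ext _ _ ?_ ?_
  · rw [graphInsertion, biprod.lift_fst, Category.assoc, biprod.inr_fst, comp_zero]
    refine biproduct.hom_ext _ _ fun i => ?_
    simp
  · rw [graphInsertion, biprod.lift_snd, Category.assoc, biprod.inr_snd, Category.comp_id]

theorem graphInsertion_naturality (d : ℕ) (I : Finset (Fin (d + 1))) {a a' b b' : 𝒜}
    {f : a ⟶ b} {f' : a' ⟶ b'} {φ : a ⟶ a'} {ψ : b ⟶ b'} (h : φ ≫ f' = f ≫ ψ) :
    φ ≫ graphInsertion d I f' = graphInsertion d I f ≫ biprod.map (biproduct.map fun _ => φ) ψ := by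
  refine biprod.hom_ext _ _ ?_ ?_
  · simp only [graphInsertion, Category.assoc, biprod.lift_fst, biprod.map_fst,
      biprod.lift_fst_assoc]
    refine biproduct.hom_ext _ _ fun i => ?_
    simp only [Category.assoc, biproduct.lift_π, biproduct.map_π, biproduct.lift_π_assoc]
    split_ifs <;> simp
  · simpa [graphInsertion] using h

/-- Any component indexed by `I` is an identity and provides the retraction, whatever `f` is. -/
theorem isSplitMono_graphInsertion (d : ℕ) {I : Finset (Fin (d + 1))} (hI : I.Nonempty)
    {a b : 𝒜} (f : a ⟶ b) : IsSplitMono (graphInsertion d I f) := by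
  obtain ⟨i, hi⟩ := hI
  refine .mk' ⟨biprod.fst ≫ biproduct.π (fun _ => a) i, ?_⟩
  rw [graphInsertion, ← Category.assoc, biprod.lift_fst, biproduct.lift_π, if_pos hi]

theorem isSplitMono_biprodMap {a a' b b' : 𝒜} (φ : a ⟶ a') (ψ : b ⟶ b') [IsSplitMono φ]
    [IsSplitMono ψ] : IsSplitMono (biprod.map φ ψ) :=
  .mk' ⟨biprod.map (retraction φ) (retraction ψ), by
    refine biprod.hom_ext _ _ ?_ ?_ <;> simp⟩

/-- The graph is the sum of `f ≫ biprod.inr` and the inclusions indexed by `I`, so this is a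
deviation of `A.map` based at `f ≫ biprod.inr` instead of at 0. -/
theorem sum_map_graphInsertion_eq_zero {A : 𝒜 ⥤ ModuleCat.{w} k} {d : ℕ}
    (hA : IsPolynomialOfDegreeLE A d) {a b : 𝒜} (f : a ⟶ b) :
    ∑ I : Finset (Fin (d + 1)), (-1 : ℤ) ^ I.card • A.map (graphInsertion d I f) = 0 := by
  refine Eq.trans (Finset.sum_congr rfl fun I _ => ?_) (sum_deviation_eq_zero A.map
    (sum_map_sum_eq_zero hA) (fun i => biproduct.ι (fun _ => a) i ≫ biprod.inl) (f ≫ biprod.inr))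
  congr 2
  rw [← Preadditive.sum_comp, add_comm (f ≫ _), graphInsertion, biprod.lift_eq]
  congr 2
  refine biproduct.hom_ext _ _ fun j => ?_
  rw [biproduct.lift_π, Preadditive.sum_comp]
  simp [biproduct.ι_π]

/-! ### Natural transformations out of polynomial functors -/

/-- For nonempty `I`, naturality along the graph followed by the projection to `b` gives `φ a ≫
F.map f`. For `I = ∅`, naturality along `biprod.inr` alone gives `A.map f ≫ φ b`. Polynomiality
equates the two. -/
theorem naturality_of_splitMonos {A F : 𝒜 ⥤ ModuleCat.{w} k} {d : ℕ}
    (hA : IsPolynomialOfDegreeLE A d) (φ : ∀ a : 𝒜, A.obj a ⟶ F.obj a)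
    (hφ : ∀ ⦃a b : 𝒜⦄ (f : a ⟶ b) [IsSplitMono f], A.map f ≫ φ b = φ a ≫ F.map f)
    {a b : 𝒜} (f : a ⟶ b) : A.map f ≫ φ b = φ a ≫ F.map f := by
  have h := congrArg (fun θ => θ ≫ φ _ ≫ F.map biprod.snd) (sum_map_graphInsertion_eq_zero hA f)
  simp only [Preadditive.sum_comp, Preadditive.zsmul_comp, zero_comp] at h
  have h₁ (I : Finset (Fin (d + 1))) (hI : I ≠ ∅) :
      A.map (graphInsertion d I f) ≫ φ _ ≫ F.map biprod.snd = φ a ≫ F.map f := by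
    have := isSplitMono_graphInsertion d (Finset.nonempty_iff_ne_empty.2 hI) f
    rw [← Category.assoc, hφ, Category.assoc, ← F.map_comp, graphInsertion_snd]
  have h₂ : A.map (graphInsertion d ∅ f) ≫ φ _ ≫ F.map biprod.snd = A.map f ≫ φ b := by
    rw [graphInsertion_empty, A.map_comp, Category.assoc, ← Category.assoc (A.map biprod.inr),
      hφ, Category.assoc, ← F.map_comp, biprod.inr_snd, F.map_id, Category.comp_id]
  exact h₂.symm.trans (eq_of_alternating_sum_eq_zero _ _ h₁ h)

theorem restriction_map_bijective {A : 𝒜 ⥤ ModuleCat.{w} k} (hA : IsPolynomial A)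
    (F : 𝒜 ⥤ ModuleCat.{w} k) :
    Function.Bijective ((restriction 𝒜 k).map : (A ⟶ F) → _) := by
  obtain ⟨d, hA⟩ := hA
  refine ⟨fun θ θ' h => ?_, fun φ => ?_⟩
  · ext a : 2
    exact NatTrans.congr_app h (⟨a⟩ : M 𝒜)
  · exact ⟨{ app := fun a => φ.app ⟨a⟩
             naturality := fun a b f => naturality_of_splitMonos hA (fun a => φ.app ⟨a⟩)
              (fun a b f hf => φ.naturality (X := ⟨a⟩) (Y := ⟨b⟩) ⟨f, hf⟩) f }, rfl⟩

end Stabilization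

end

end Scorichenko

namespace Scorichenko

noncomputable section

open Abelian

universe v₁ v₂ u₁ u₂

/-! ### Coinduced functors and the category of arrows over the objects `R b` -/

section Restriction

variable {C : Type u₁} [Category.{v₁} C] {D : Type u₂} [Category.{v₂} D]
  (k : Type w) [CommRing k]

/-- Precomposition with a functor, on categories of functors to `k`-modules. -/
abbrev precomp (T : C ⥤ D) : (D ⥤ ModuleCat.{w} k) ⥤ (C ⥤ ModuleCat.{w} k) :=
  (Functor.whiskeringLeft C D (ModuleCat.{w} k)).obj T

instance preservesFiniteLimits_precomp (T : C ⥤ D) : PreservesFiniteLimits (precomp k T) :=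
  ⟨fun _ => inferInstance⟩

instance preservesFiniteColimits_precomp (T : C ⥤ D) : PreservesFiniteColimits (precomp k T) :=
  ⟨fun _ => inferInstance⟩

end Restriction

section Comma

variable {𝒜 : Type u} [Category.{v} 𝒜] {k : Type w} [CommRing k] {J : Type w}
  (R : Discrete J ⥤ 𝒜)

/-- A morphism from the values of `F` on `R` induces a morphism to a coinduced functor. -/
def toCoinduce [LocallySmall.{w} 𝒜] {F : 𝒜 ⥤ ModuleCat.{w} k} {E : Discrete J ⥤ ModuleCat.{w} k}
    (j : R ⋙ F ⟶ E) : F ⟶ (coinduce (𝟭 𝒜) R).obj (Comma.snd _ R ⋙ E) where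
  app a := coinduceLift (L := 𝟭 𝒜) (Comma.snd _ R ⋙ E) fun b f => F.map f ≫ j.app b
  naturality a a' φ := by
    refine coinduceObj_hom_ext (G := Comma.snd _ R ⋙ E) fun b f => ?_
    refine (Category.assoc _ _ _).trans ?_
    refine (congrArg (F.map φ ≫ ·) (coinduceLift_proj _ _ _ _)).trans ?_
    refine Eq.trans ?_ (Category.assoc _ _ _).symm
    refine Eq.trans ?_ (congrArg (_ ≫ ·) (coinduceObj_map_proj_mk _ _ _ _).symm)
    refine Eq.trans ?_ (coinduceLift_proj_assoc _ _ _ _ _).symm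
    refine Eq.trans ?_ (congrArg (_ ≫ ·) (E.map_id b).symm)
    refine Eq.trans ?_ (Category.comp_id _).symm
    rw [← Category.assoc, ← F.map_comp]
    rfl

/-- At an isomorphism `a ≅ R b`, the component of the map is already a monomorphism. -/
theorem mono_toCoinduce [LocallySmall.{w} 𝒜] [R.EssSurj] {F : 𝒜 ⥤ ModuleCat.{w} k}
    {E : Discrete J ⥤ ModuleCat.{w} k} (j : R ⋙ F ⟶ E) [Mono j] : Mono (toCoinduce R j) := by
  have (a : 𝒜) : Mono ((toCoinduce R j).app a) := by
    let e := R.objObjPreimageIso a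
    have h : (toCoinduce R j).app a ≫ coinduceProj (L := 𝟭 𝒜) (Comma.snd _ R ⋙ E)
        ⟨a, R.objPreimage a, e.inv⟩ = F.map e.inv ≫ j.app (R.objPreimage a) :=
      coinduceLift_proj _ _ _ _
    exact mono_of_mono_fac h
  exact NatTrans.mono_of_mono_app _

/-- The category of morphisms `a ⟶ R b` of `𝒜`, in which the morphisms are split monomorphisms
`a ⟶ a'` over the objects `R b`. -/
abbrev MOver : Type _ := Comma (wideSubcategoryInclusion (splitMonos 𝒜)) R

variable {R} in
theorem MOver.hom_ext {c c' : MOver R} {m m' : c ⟶ c'} (h : m.left.hom = m'.left.hom) :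
    m = m' :=
  CommaMorphism.ext (WideSubcategory.hom_ext _ h) (Subsingleton.elim _ _)

/-- The objects `𝟙 (R b)` of `MOver R`. -/
@[simps]
def idSection : Discrete J ⥤ MOver R where
  obj b := ⟨⟨R.obj b⟩, b, 𝟙 _⟩
  map m := { left := ⟨R.map m, (inferInstance : IsSplitMono (R.map m))⟩, right := m }

end Comma

/-! ### The stabilization functor -/

section Stabilization

attribute [local instance] hasBinaryBiproducts_of_finite_biproducts essentiallySmall_comma

variable {𝒜 : Type u} [Category.{v} 𝒜] [Preadditive 𝒜] [HasFiniteBiproducts 𝒜]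
  {k : Type w} [CommRing k] {J : Type w} (R : Discrete J ⥤ 𝒜)

theorem biprodMap_biproductMap_id (d : ℕ) (a b : 𝒜) :
    biprod.map (biproduct.map fun _ : Fin (d + 1) => 𝟙 a) (𝟙 b) = 𝟙 _ := by
  refine biprod.hom_ext _ _ ?_ (by simp)
  rw [biprod.map_fst, Category.id_comp]
  refine Eq.trans ?_ (Category.comp_id _)
  congr 1
  exact biproduct.hom_ext _ _ fun i => by simp

theorem biprodMap_biproductMap_comp (d : ℕ) {a a' a'' b b' b'' : 𝒜} (φ : a ⟶ a') (φ' : a' ⟶ a'')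
    (ψ : b ⟶ b') (ψ' : b' ⟶ b'') :
    biprod.map (biproduct.map fun _ : Fin (d + 1) => φ ≫ φ') (ψ ≫ ψ') =
      biprod.map (biproduct.map fun _ => φ) ψ ≫ biprod.map (biproduct.map fun _ => φ') ψ' := by
  refine biprod.hom_ext _ _ ?_ (by simp)
  rw [biprod.map_fst, Category.assoc, biprod.map_fst, ← Category.assoc, biprod.map_fst,
    Category.assoc]
  congr 1
  exact biproduct.hom_ext _ _ fun i => by simp

/-- The endofunctor of `MOver R` which sends `a ⟶ b` to the projection `a ^ ⊕(d+1) ⊞ b ⟶ b`. -/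
@[simps]
def stabilize (d : ℕ) : MOver R ⥤ MOver R where
  obj c := ⟨⟨(⨁ fun _ : Fin (d + 1) => c.left.obj) ⊞ R.obj c.right⟩, c.right, biprod.snd⟩
  map {c c'} m :=
    { left := ⟨biprod.map (biproduct.map fun _ => m.left.hom) (R.map m.right), by
        have : IsSplitMono m.left.hom := m.left.property
        have : IsSplitMono (biproduct.map fun _ : Fin (d + 1) => m.left.hom) :=
          inferInstanceAs (IsSplitMono ((t 𝒜 d).map m.left.hom))
        exact isSplitMono_biprodMap _ _⟩
      right := m.right
      w := biprod.map_snd _ _ }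
  map_id c := MOver.hom_ext ((congrArg (biprod.map _) (R.map_id c.right)).trans
    (biprodMap_biproductMap_id d _ _))
  map_comp m m' := MOver.hom_ext ((congrArg (biprod.map _) (R.map_comp m.right m'.right)).trans
    (biprodMap_biproductMap_comp d _ _ _ _))

/-- The natural transformation to the stabilization functor given by a nonempty subset of
`{0, …, d}`. -/
def toStabilize (d : ℕ) {I : Finset (Fin (d + 1))} (hI : I.Nonempty) :
    𝟭 (MOver R) ⟶ stabilize R d where
  app c :=
    { left := ⟨graphInsertion d I c.hom, isSplitMono_graphInsertion d hI _⟩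
      right := 𝟙 _
      w := by
        refine (graphInsertion_snd _ _ _).trans ?_
        exact ((congrArg (c.hom ≫ ·) (R.map_id _)).trans (Category.comp_id _)).symm }
  naturality c c' m := MOver.hom_ext (graphInsertion_naturality d I m.w)

/-- The natural transformation from the objects `𝟙 (R b)` to the stabilization functor given by
the inclusion of the second summand. -/
def idToStabilize (d : ℕ) : Comma.snd _ R ⋙ idSection R ⟶ stabilize R d where
  app c :=
    { left := ⟨biprod.inr, (inferInstance : IsSplitMono
        (biprod.inr : _ ⟶ (⨁ fun _ : Fin (d + 1) => c.left.obj) ⊞ R.obj c.right))⟩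
      right := 𝟙 _
      w := by
        refine biprod.inr_snd.trans ?_
        exact ((Category.id_comp _).trans (R.map_id _)).symm }
  naturality c c' m := MOver.hom_ext (biprod.inr_map _ _).symm

/-- The restriction to `MOver R` of a functor on `𝒜`. -/
abbrev pullback (A : 𝒜 ⥤ ModuleCat.{w} k) : MOver R ⥤ ModuleCat.{w} k :=
  Comma.fst _ R ⋙ (restriction 𝒜 k).obj A

/-- The morphism to its stabilization that an arbitrary subset of `{0, …, d}` induces on the
restriction of a functor on `𝒜`. -/
def pullbackToStabilize (A : 𝒜 ⥤ ModuleCat.{w} k) (d : ℕ) (I : Finset (Fin (d + 1))) :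
    pullback R A ⟶ (precomp k (stabilize R d)).obj (pullback R A) where
  app c := A.map (graphInsertion d I c.hom)
  naturality c c' m := by
    refine (A.map_comp _ _).symm.trans (Eq.trans ?_ (A.map_comp _ _))
    exact congrArg A.map (graphInsertion_naturality d I m.w)

theorem sum_pullbackToStabilize_eq_zero {A : 𝒜 ⥤ ModuleCat.{w} k} {d : ℕ}
    (hA : IsPolynomialOfDegreeLE A d) :
    ∑ I : Finset (Fin (d + 1)), (-1 : ℤ) ^ I.card • pullbackToStabilize R A d I = 0 := by
  ext c : 2
  rw [NatTrans.app_sum]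
  exact sum_map_graphInsertion_eq_zero hA c.hom

/-- The natural transformation from a functor on `MOver R` to its stabilization. -/
def precompToStabilize (d : ℕ) {I : Finset (Fin (d + 1))} (hI : I.Nonempty) :
    𝟭 _ ⟶ precomp k (stabilize R d) where
  app X :=
    { app := fun c => X.map ((toStabilize R d hI).app c)
      naturality := fun c c' m => by
        refine (X.map_comp _ _).symm.trans (Eq.trans ?_ (X.map_comp _ _))
        exact congrArg X.map ((toStabilize R d hI).naturality m) }

/-- The natural transformation from the values of a functor on `MOver R` at the identities to its
stabilization. -/
def precompIdToStabilize (d : ℕ) :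
    precomp k (idSection R) ⋙ precomp k (Comma.snd _ R) ⟶ precomp k (stabilize R d) where
  app X :=
    { app := fun c => X.map ((idToStabilize R d).app c)
      naturality := fun c c' m => by
        refine (X.map_comp _ _).symm.trans (Eq.trans ?_ (X.map_comp _ _))
        exact congrArg X.map ((idToStabilize R d).naturality m) }

/-- The canonical morphism from the restriction to `MOver R` of a functor on `𝒜` to its values at
the identities. -/
def pullbackToId (A : 𝒜 ⥤ ModuleCat.{w} k) : pullback R A ⟶
    (precomp k (idSection R) ⋙ precomp k (Comma.snd _ R)).obj (pullback R A) where
  app c := A.map c.hom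
  naturality c c' m := by
    refine (A.map_comp _ _).symm.trans (Eq.trans ?_ (A.map_comp _ _))
    exact congrArg A.map m.w

theorem pullbackToStabilize_empty (A : 𝒜 ⥤ ModuleCat.{w} k) (d : ℕ) :
    pullbackToStabilize R A d ∅ =
      pullbackToId R A ≫ (precompIdToStabilize R d).app (pullback R A) := by
  ext c : 2
  exact (congrArg A.map (graphInsertion_empty d c.hom)).trans (A.map_comp _ _)

/-- Functors pulled back from `Discrete J` are invariant under stabilization. -/
def sndStabilizeIso (E : Discrete J ⥤ ModuleCat.{w} k) (d : ℕ) :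
    (Comma.snd _ R ⋙ E : MOver R ⥤ _) ≅ (precomp k (stabilize R d)).obj (Comma.snd _ R ⋙ E) :=
  NatIso.ofComponents (fun _ => Iso.refl _) fun _ =>
    (Category.comp_id _).trans (Category.id_comp _).symm

/-- Stabilization leaves the target `R b` untouched, so the map is the same for every nonempty `I`.
-/
theorem precompToStabilize_app_snd (E : Discrete J ⥤ ModuleCat.{w} k) (d : ℕ)
    {I : Finset (Fin (d + 1))} (hI : I.Nonempty) :
    (precompToStabilize R d hI).app (Comma.snd _ R ⋙ E) = (sndStabilizeIso R E d).hom := by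
  ext c : 2
  exact E.map_id _

/-- Extensions of a functor pulled back from `Discrete J` with injective values by the restriction
of a polynomial functor vanish in positive degrees. -/
theorem ext_pullback_snd_eq_zero [EssentiallySmall.{w} 𝒜] {A : 𝒜 ⥤ ModuleCat.{w} k} {d : ℕ}
    (hA : IsPolynomialOfDegreeLE A d) (E : Discrete J ⥤ ModuleCat.{w} k) [Injective E] {n : ℕ}
    (x : Ext.{w} (pullback R A) (Comma.snd _ R ⋙ E : MOver R ⥤ _) (n + 1)) : x = 0 := by
  let y := x.mapExactFunctor (precomp k (stabilize R d))
  let Φ : (pullback R A ⟶ (precomp k (stabilize R d)).obj (pullback R A)) →+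
      Ext.{w} (pullback R A) ((precomp k (stabilize R d)).obj (Comma.snd _ R ⋙ E)) (n + 1) :=
    AddMonoidHom.mk' (fun θ => (Ext.mk₀ θ).comp y (zero_add _)) fun θ θ' => by
      rw [Ext.mk₀_add, Ext.add_comp]
  let z := x.comp (Ext.mk₀ (sndStabilizeIso R E d).hom) (add_zero _)
  -- For nonempty `I` the map comes from a transformation of endofunctors of `MOver R`, so
  -- naturality on `Ext` replaces `y` by `x`, up to the invariance isomorphism.
  have hΦ (I : Finset (Fin (d + 1))) (hI : I ≠ ∅) : Φ (pullbackToStabilize R A d I) = z := by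
    have h := Ext.mapExactFunctor_naturality
      (precompToStabilize R d (Finset.nonempty_iff_ne_empty.2 hI)) x
    rw [Ext.mapExactFunctor_id, precompToStabilize_app_snd] at h
    exact h
  -- For `I = ∅` the class factors through the restriction of `x` along `idSection R`, whose target
  -- is the injective `E` itself.
  have hΦ₀ : Φ (pullbackToStabilize R A d ∅) = 0 := by
    have h := Ext.mapExactFunctor_naturality (precompIdToStabilize R d) x
    have hinj : Injective ((precomp k (idSection R)).obj (Comma.snd _ R ⋙ E)) :=
      inferInstanceAs (Injective E)
    rw [Ext.mapExactFunctor_functorComp,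
      Ext.eq_zero_of_injective (x.mapExactFunctor (precomp k (idSection R))),
      Ext.mapExactFunctor_zero, Ext.zero_comp] at h
    change (Ext.mk₀ (pullbackToStabilize R A d ∅)).comp y (zero_add _) = 0
    rw [pullbackToStabilize_empty, ← Ext.mk₀_comp_mk₀_assoc, h, Ext.comp_zero]
  have h := congrArg Φ (sum_pullbackToStabilize_eq_zero R hA)
  rw [map_sum, map_zero] at h
  simp only [map_zsmul] at h
  replace h : z = 0 := (eq_of_alternating_sum_eq_zero _ z hΦ h).symm.trans hΦ₀
  have hz := congrArg (fun z => Ext.comp z (Ext.mk₀ (sndStabilizeIso R E d).inv) (add_zero _)) h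
  simpa [z] using hz

/-! ### Acyclicity of restrictions of injective functors -/

theorem ext_restriction_coinduce_eq_zero [EssentiallySmall.{w} 𝒜] {A : 𝒜 ⥤ ModuleCat.{w} k}
    (hA : IsPolynomial A) (E : Discrete J ⥤ ModuleCat.{w} k) [Injective E] {n : ℕ}
    (x : Ext.{w} ((restriction 𝒜 k).obj A)
      ((restriction 𝒜 k).obj ((coinduce (𝟭 𝒜) R).obj (Comma.snd _ R ⋙ E))) (n + 1)) : x = 0 := by
  obtain ⟨d, hA⟩ := hA
  -- Restricting the coinduced functor to split monomorphisms keeps the same products, indexed by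
  -- all morphisms `a ⟶ R b` of `𝒜`; it is thus coinduced from `MOver R`.
  exact Ext.eq_zero_of_adjunction
    (coinduceAdjunction (wideSubcategoryInclusion (splitMonos 𝒜)) R (k := k))
    (Y := Comma.snd _ R ⋙ E) (fun y => ext_pullback_snd_eq_zero R hA E y) x

/-- With `R` running over a small set of representatives of the objects, `F` embeds in a coinduced
functor. Injectivity splits the embedding, so the vanishing passes to the retract `F`. -/
theorem ext_restriction_injective_eq_zero [EssentiallySmall.{w} 𝒜] {A : 𝒜 ⥤ ModuleCat.{w} k}
    (hA : IsPolynomial A) (F : 𝒜 ⥤ ModuleCat.{w} k) [Injective F] (n : ℕ)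
    (x : Ext.{w} ((restriction 𝒜 k).obj A) ((restriction 𝒜 k).obj F) (n + 1)) : x = 0 := by
  let R : Discrete (SmallModel.{w} 𝒜) ⥤ 𝒜 := Discrete.functor (equivSmallModel.{w} 𝒜).inverse.obj
  have : R.EssSurj := ⟨fun a => ⟨⟨(equivSmallModel.{w} 𝒜).functor.obj a⟩,
    ⟨(equivSmallModel.{w} 𝒜).unitIso.symm.app a⟩⟩⟩
  let i := toCoinduce R (Injective.ι (R ⋙ F))
  have : Mono i := mono_toCoinduce R _
  have h := ext_restriction_coinduce_eq_zero R hA _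
    (x.comp (Ext.mk₀ ((restriction 𝒜 k).map i)) (add_zero _))
  have hz := congrArg (fun z => Ext.comp z
    (Ext.mk₀ ((restriction 𝒜 k).map (Injective.factorThru (𝟙 F) i))) (add_zero _)) h
  rw [Ext.comp_assoc_of_third_deg_zero, Ext.mk₀_comp_mk₀, ← Functor.map_comp,
    Injective.comp_factorThru, CategoryTheory.Functor.map_id, Ext.comp_mk₀_id, Ext.zero_comp] at hz
  exact hz

end Stabilization

end

end Scorichenko

theorem mainTheorem1 {k : Type w} [CommRing k]
    {𝒜 : Type u} [Category.{v} 𝒜] [Preadditive 𝒜] [HasFiniteBiproducts 𝒜]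
    [EssentiallySmall.{w} 𝒜]
    (A F : 𝒜 ⥤ ModuleCat.{w} k) (hA : Scorichenko.IsPolynomial A) (n : ℕ) :
    Function.Bijective ((Scorichenko.restriction 𝒜 k).mapExtLinearMap k A F n :
      Abelian.Ext.{w} A F n →ₗ[k]
        Abelian.Ext.{w} ((Scorichenko.restriction 𝒜 k).obj A)
          ((Scorichenko.restriction 𝒜 k).obj F) n) :=
  Abelian.Ext.mapExactFunctor_bijective _ A (Scorichenko.restriction_map_bijective hA)
    (fun I _ => Scorichenko.ext_restriction_injective_eq_zero hA I) F n
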